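/- Let $(A,A^+,1)$ be an order unit Banach space, i.e. an archimedean partially ordered real vector space with order unit $1$ that is complete in the order unit norm $\|a\|=\inf\{\lambda\ge 0: -\lambda 1\le a\le\lambda 1\}$, and let $E=\{e\in A: 0\le e\le 1\}$. A *compression with focus $p\in E$* is a positive linear map $J:A\to A$ with $J(1)=p$ such that for all $e\in E$: $e\le p$ implies $J(e)=e$, and $J(e)=0$ implies $e\le 1-p$. Let $(J_p)_{p\in P}$ be a *compression base* for $A$: a family of compressions indexed by their foci, where $P\subseteq E$ contains $1$, is closed under $p\mapsto 1-p$ and under sums $p+q\le 1$, and is normal ($d,e,f\in E$, $d+e+f\le 1$ and $d+e,\,d+f\in P$ imply $d\in P$), and where $J_{p+r}\circ J_{q+r}=J_r$ whenever $p,q,r\in P$ and $p+q+r\le 1$. The elements of $P$ are called projections. An element $a\in A$ commutes with $p\in P$ if $a=J_p(a)+J_{1-p}(a)$. For $B\subseteq A$ let $PC(B)$ be the set of all $p\in P$ commuting with every element of $B$, and for $a\in A$ let $P(a)=PC(PC(\{a\})\cup\{a\})$. Assume the *comparability property*: for every $a\in A$ there is $p\in P(a)$ with $J_{1-p}(a)\le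 0\le J_p(a)$. A *JB-product* on $A$ is a commutative bilinear product $\circ$ with identity $1$ such that, for all $a,b\in A$ and with $a^2=a\circ a$, one has $(a^2\circ b)\circ a=a^2\circ(b\circ a)$, $\|a\circ b\|\le\|a\|\,\|b\|$, $\|a^2\|=\|a\|^2$ and $\|a^2\|\le\|a^2+b^2\|$, where $\|\cdot\|$ is the order unit norm. We say that $A$ is a JB-algebra if a JB-product on $A$ exists. For $p\in P$ put $T_p=\tfrac12(I+J_p-J_{1-p})$. Then: 1. $A$ is a JB-algebra if and only if $J_p(q)+J_{1-p}(1-q)=J_q(p)+J_{1-q}(1-p)$ for all $p,q\in P$. 2. $A$ is a JB-algebra if and only if $T_p(q)=T_q(p)$ for all $p,q\in P$. In fact, for each pair $p,q\in P$, the equation $T_p(q)=T_q(p)$ is equivalent to the equation in 1. 3. For every JB-product $\circ$ on $A$, one has $p\circ a=T_p(a)$ for all $p\in P$ and $a\in A$. -/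

import Mathlib

/-- The unit interval `E = {e | 0 ≤ e ≤ 1}` of an ordered vector space with distinguished element
`u` (written `1` in the mathematics). -/
def unitEffects {A : Type*} [Zero A] [PartialOrder A] (u : A) : Set A :=
  {e | 0 ≤ e ∧ e ≤ u}

/-- The order unit norm `inf {t ≥ 0 | -t u ≤ a ≤ t u}`. -/
noncomputable def orderUnitNorm {A : Type*} [AddCommGroup A] [Module ℝ A] [PartialOrder A]
    (u a : A) : ℝ :=
  sInf {t : ℝ | 0 ≤ t ∧ -(t • u) ≤ a ∧ a ≤ t • u}

/-- A partially ordered real vector space `A` is an order unit space with order unit `u`, and its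
norm is the order unit norm. (That the order is translation invariant and invariant under
multiplication by nonnegative scalars is expressed by `IsOrderedAddMonoid` and `PosSMulMono`.) -/
structure IsOrderUnitSpace (A : Type*) [NormedAddCommGroup A] [NormedSpace ℝ A] [PartialOrder A]
    [IsOrderedAddMonoid A] [PosSMulMono ℝ A] (u : A) : Prop where
  unit_nonneg : 0 ≤ u
  exists_le_smul : ∀ a : A, ∃ t : ℝ, a ≤ t • u
  archimedean : ∀ a b : A, (∀ n : ℕ, n • a ≤ b) → a ≤ 0
  norm_eq : ∀ a : A, ‖a‖ = orderUnitNorm u a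

section OrderedVectorSpace

variable {A : Type*} [AddCommGroup A] [Module ℝ A] [PartialOrder A]

/-- `J` is a compression with focus `p`: a positive linear map with image of
`u` equal to `p`, fixing the effects below `p`, and killing only effects below `u - p`. -/
structure IsCompression (u p : A) (J : A →ₗ[ℝ] A) : Prop where
  positive : ∀ a : A, 0 ≤ a → 0 ≤ J a
  map_unit : J u = p
  focus_mem : p ∈ unitEffects u
  map_of_le : ∀ e ∈ unitEffects u, e ≤ p → J e = e
  le_of_map_eq_zero : ∀ e ∈ unitEffects u, J e = 0 → e ≤ u - p

/-- `P` is a normal subalgebra of the effect algebra `E` of all `e` with `0 ≤ e ≤ u`. -/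
structure IsNormalSubalgebra (u : A) (P : Set A) : Prop where
  subset : P ⊆ unitEffects u
  unit_mem : u ∈ P
  compl_mem : ∀ p ∈ P, u - p ∈ P
  add_mem : ∀ p ∈ P, ∀ q ∈ P, p + q ≤ u → p + q ∈ P
  normal : ∀ d ∈ unitEffects u, ∀ e ∈ unitEffects u, ∀ f ∈ unitEffects u,
    d + e + f ≤ u → d + e ∈ P → d + f ∈ P → d ∈ P

/-- `(J p)` for `p ∈ P` is a compression base. The values of `J` outside `P` play no role. -/
structure IsCompressionBase (u : A) (P : Set A) (J : A → A →ₗ[ℝ] A) : Prop where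
  normalSubalgebra : IsNormalSubalgebra u P
  compression : ∀ p ∈ P, IsCompression u p (J p)
  comp_eq : ∀ p ∈ P, ∀ q ∈ P, ∀ r ∈ P, p + q + r ≤ u → (J (p + r)).comp (J (q + r)) = J r

/-- The commutant `C(p)`: the set of all `a` with `a = J_p(a) + J_{1-p}(a)`. -/
def commutantOf (u : A) (J : A → A →ₗ[ℝ] A) (p : A) : Set A :=
  {a | a = J p a + J (u - p) a}

/-- `PC(B)`: the projections commuting with all elements of `B`. -/
def projCommutant (u : A) (P : Set A) (J : A → A →ₗ[ℝ] A) (B : Set A) : Set A :=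
  {p | p ∈ P ∧ ∀ b ∈ B, b ∈ commutantOf u J p}

/-- The P-bicommutant `P(a) = PC(PC(a) ∪ {a})`. -/
def projBicommutant (u : A) (P : Set A) (J : A → A →ₗ[ℝ] A) (a : A) : Set A :=
  projCommutant u P J (projCommutant u P J {a} ∪ {a})

/-- The comparability property: for every `a` there is `p ∈ P(a)` with
`J_{1-p}(a) ≤ 0 ≤ J_p(a)`. -/
def HasComparability (u : A) (P : Set A) (J : A → A →ₗ[ℝ] A) : Prop :=
  ∀ a : A, ∃ p ∈ projBicommutant u P J a, J (u - p) a ≤ 0 ∧ 0 ≤ J p a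

end OrderedVectorSpace

/-- The operator `T_p = (I + J_p - J_{1-p}) / 2`. -/
noncomputable def multOp {A : Type*} [AddCommGroup A] [Module ℝ A] (u : A) (J : A → A →ₗ[ℝ] A)
    (p : A) : A →ₗ[ℝ] A :=
  (2⁻¹ : ℝ) • (LinearMap.id + J p - J (u - p))

/-- The bilinear product `m` makes `A`, with its given norm, a JB-algebra with identity `u`. -/
structure IsJBProduct {A : Type*} [NormedAddCommGroup A] [NormedSpace ℝ A] (u : A)
    (m : A →ₗ[ℝ] A →ₗ[ℝ] A) : Prop where
  complete : CompleteSpace A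
  comm : ∀ a b : A, m a b = m b a
  jordan : ∀ a b : A, m (m (m a a) b) a = m (m a a) (m b a)
  unit_mul : ∀ a : A, m u a = a
  norm_mul_le : ∀ a b : A, ‖m a b‖ ≤ ‖a‖ * ‖b‖
  norm_sq : ∀ a : A, ‖m a a‖ = ‖a‖ ^ 2
  norm_sq_le : ∀ a b : A, ‖m a a‖ ≤ ‖m a a + m b b‖

/-- `A`, with its given norm and the distinguished element `u` as identity, is a JB-algebra for some
product. In an order unit space with order unit `u` and the order unit norm, the cone is
recovered from these data: `0 ≤ a` if and only if `‖‖a‖ • u - a‖ ≤ ‖a‖`. -/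
def IsJBAlgebra (A : Type*) [NormedAddCommGroup A] [NormedSpace ℝ A] (u : A) : Prop :=
  ∃ m : A →ₗ[ℝ] A →ₗ[ℝ] A, IsJBProduct u m

/-!
In a JB-algebra, `p ∘ ·` satisfies the cubic `2T³ - 3T² + T = 0` for every idempotent `p`, so the
algebra is the sum of the eigenspaces of `p ∘ ·` for `1`, `1/2` and `0`. The elements of the first
and the last lie between multiples of `p` and of `1 - p` respectively, so a compression with focus
`p` fixes the first and kills the last; as squares are positive, it kills the middle one as well.
This determines `J_p` and `J_{1-p}` and gives `p ∘ a = T_p a`; commutativity then yields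
`T_p q = T_q p`.

Conversely, comparability makes the elements `∑ αᵢ pᵢ` with `∑ pᵢ = 1` dense: it splits off the
spectral projections of an element at any increasing sequence of levels. If `T_p q = T_q p` on `P`,
then every linear combination `T` of operators `T_p` satisfies `T q = T_q (T 1)`, whence
`‖T‖ ≤ 4 ‖T 1‖`. So `T 1 ↦ T` extends to a bounded bilinear product on the whole space. For
elements `∑ αᵢ pᵢ` the square is `∑ αᵢ² pᵢ` and the operators `T_{pᵢ}` commute, which gives the
positivity and the norm of squares and the Jordan identity; `‖a ∘ b‖ ≤ ‖a‖ ‖b‖` follows by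
polarization.
-/

/-! ### Order unit spaces and compressions -/

section OrderUnitNorm

variable {A : Type*} [NormedAddCommGroup A] [NormedSpace ℝ A] [PartialOrder A]
  [IsOrderedAddMonoid A] [PosSMulMono ℝ A] {u : A}

namespace IsOrderUnitSpace

theorem smul_unit_mono (hA : IsOrderUnitSpace A u) {s t : ℝ} (h : s ≤ t) : s • u ≤ t • u :=
  smul_le_smul_of_nonneg_right h hA.unit_nonneg

theorem norm_le_of_le (hA : IsOrderUnitSpace A u) {a : A} {t : ℝ} (ht : 0 ≤ t) (h : a ≤ t • u)
    (hneg : -a ≤ t • u) : ‖a‖ ≤ t := by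
  rw [hA.norm_eq]
  exact csInf_le ⟨0, fun _ h => h.1⟩ ⟨ht, neg_le.1 hneg, h⟩

theorem nonpos_of_forall_le_smul (hA : IsOrderUnitSpace A u) {a : A}
    (h : ∀ ε : ℝ, 0 < ε → a ≤ ε • u) : a ≤ 0 := by
  refine hA.archimedean a u fun n => ?_
  rcases Nat.eq_zero_or_pos n with rfl | hn
  · simpa using hA.unit_nonneg
  have hn' : (0 : ℝ) < n := Nat.cast_pos.2 hn
  rw [← Nat.cast_smul_eq_nsmul ℝ, ← le_inv_smul_iff_of_pos hn']
  exact h _ (inv_pos.2 hn')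

theorem exists_norm_bound (hA : IsOrderUnitSpace A u) (a : A) :
    ∃ t : ℝ, 0 ≤ t ∧ -(t • u) ≤ a ∧ a ≤ t • u := by
  obtain ⟨s, hs⟩ := hA.exists_le_smul a
  obtain ⟨t, ht⟩ := hA.exists_le_smul (-a)
  refine ⟨max 0 (max s t), le_max_left _ _, neg_le.1 (ht.trans ?_), hs.trans ?_⟩ <;>
    exact hA.smul_unit_mono (by simp)

theorem le_norm_smul (hA : IsOrderUnitSpace A u) (a : A) : a ≤ ‖a‖ • u := by
  refine sub_nonpos.1 (hA.nonpos_of_forall_le_smul fun ε hε => ?_)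
  obtain ⟨t, ⟨-, -, hat⟩, htε⟩ := exists_lt_of_csInf_lt (hA.exists_norm_bound a)
    (show orderUnitNorm u a < ‖a‖ + ε by rw [hA.norm_eq]; exact lt_add_of_pos_right _ hε)
  rw [sub_le_iff_le_add', ← add_smul]
  exact hat.trans (hA.smul_unit_mono htε.le)

theorem le_smul_of_norm_le (hA : IsOrderUnitSpace A u) {a : A} {t : ℝ} (h : ‖a‖ ≤ t) :
    a ≤ t • u :=
  (hA.le_norm_smul a).trans (hA.smul_unit_mono h)

theorem neg_le_norm_smul (hA : IsOrderUnitSpace A u) (a : A) : -a ≤ ‖a‖ • u :=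
  hA.le_smul_of_norm_le (norm_neg a).le

theorem norm_unit_le (hA : IsOrderUnitSpace A u) : ‖u‖ ≤ 1 :=
  hA.norm_le_of_le zero_le_one (one_smul ℝ u).ge
    ((neg_nonpos.2 hA.unit_nonneg).trans (by simpa using hA.unit_nonneg))

theorem norm_le_of_nonneg_of_le (hA : IsOrderUnitSpace A u) {a b : A} (ha : 0 ≤ a)
    (hab : a ≤ b) : ‖a‖ ≤ ‖b‖ :=
  hA.norm_le_of_le (norm_nonneg b) (hab.trans (hA.le_norm_smul b))
    ((neg_nonpos.2 ha).trans (smul_nonneg (norm_nonneg b) hA.unit_nonneg))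

theorem norm_sub_le_max (hA : IsOrderUnitSpace A u) {a b : A} (ha : 0 ≤ a) (hb : 0 ≤ b) :
    ‖a - b‖ ≤ max ‖a‖ ‖b‖ :=
  hA.norm_le_of_le (le_max_of_le_left (norm_nonneg a))
    ((sub_le_self a hb).trans (hA.le_smul_of_norm_le (le_max_left _ _)))
    (by rw [neg_sub]; exact (sub_le_self b ha).trans (hA.le_smul_of_norm_le (le_max_right _ _)))

theorem nonneg_iff_norm_smul_sub_le (hA : IsOrderUnitSpace A u) (a : A) :
    0 ≤ a ↔ ‖‖a‖ • u - a‖ ≤ ‖a‖ := by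
  refine ⟨fun ha => ?_, fun ha => ?_⟩
  · exact hA.norm_le_of_le (norm_nonneg a) (sub_le_self _ ha)
      ((neg_nonpos.2 (sub_nonneg.2 (hA.le_norm_smul a))).trans
        (smul_nonneg (norm_nonneg a) hA.unit_nonneg))
  · exact (sub_le_self_iff _).1 (hA.le_smul_of_norm_le ha)

theorem isClosed_nonneg (hA : IsOrderUnitSpace A u) : IsClosed {a : A | 0 ≤ a} := by
  simp only [hA.nonneg_iff_norm_smul_sub_le]
  exact isClosed_le (by fun_prop) (by fun_prop)

theorem nonneg_of_forall_add_smul_nonneg (hA : IsOrderUnitSpace A u) {a b : A}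
    (h : ∀ t : ℝ, 0 < t → 0 ≤ a + t • b) : 0 ≤ a := by
  have hclosed : IsClosed {t : ℝ | 0 ≤ a + t • b} :=
    hA.isClosed_nonneg.preimage (by fun_prop : Continuous fun t : ℝ => a + t • b)
  have hzero : 0 ≤ a + (0 : ℝ) • b :=
    closure_minimal h hclosed (closure_Ioi (0 : ℝ) ▸ Set.self_mem_Ici)
  rwa [zero_smul, add_zero] at hzero

theorem norm_map_le (hA : IsOrderUnitSpace A u) {J : A →ₗ[ℝ] A} (hJ : ∀ a, 0 ≤ a → 0 ≤ J a)
    (hu : J u ≤ u) (a : A) : ‖J a‖ ≤ ‖a‖ := by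
  have map_le (b : A) : J b ≤ ‖b‖ • u := by
    have h := hJ _ (sub_nonneg.2 (hA.le_norm_smul b))
    rw [map_sub, map_smul, sub_nonneg] at h
    exact h.trans (smul_le_smul_of_nonneg_left hu (norm_nonneg b))
  exact hA.norm_le_of_le (norm_nonneg a) (map_le a) (by simpa using map_le (-a))

end IsOrderUnitSpace

end OrderUnitNorm

namespace IsCompression

section Order

variable {A : Type*} [AddCommGroup A] [Module ℝ A] [PartialOrder A] {u p : A} {J : A →ₗ[ℝ] A}

theorem map_focus (h : IsCompression u p J) : J p = p :=
  h.map_of_le p h.focus_mem le_rfl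

theorem map_compl (h : IsCompression u p J) : J (u - p) = 0 := by
  rw [map_sub, h.map_unit, h.map_focus, sub_self]

variable [IsOrderedAddMonoid A]

theorem mono (h : IsCompression u p J) {a b : A} (hab : a ≤ b) : J a ≤ J b := by
  rw [← sub_nonneg, ← map_sub]
  exact h.positive _ (sub_nonneg.2 hab)

theorem map_eq_zero_of_le_smul (h : IsCompression u p J) {x : A} {c : ℝ}
    (hx : x ≤ c • (u - p)) (hneg : -x ≤ c • (u - p)) : J x = 0 := by
  have hJx := h.mono hx
  have hJneg := h.mono hneg
  rw [map_smul, h.map_compl, smul_zero] at hJx hJneg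
  exact le_antisymm hJx (by rwa [map_neg, neg_nonpos] at hJneg)

theorem map_eq_self_of_le_smul [PosSMulMono ℝ A] (h : IsCompression u p J) {x : A} {c : ℝ}
    (hx : x ≤ c • p) (hneg : -x ≤ c • p) : J x = x := by
  have hp := h.focus_mem
  set d := |c| + 1
  have hd : 0 < 2 * d := by positivity
  have hcd : c • p ≤ d • p :=
    smul_le_smul_of_nonneg_right ((le_abs_self c).trans (le_add_of_nonneg_right zero_le_one)) hp.1
  have hnonneg : 0 ≤ (2 * d)⁻¹ • (x + d • p) :=
    smul_nonneg (inv_nonneg.2 hd.le) (neg_le_iff_add_nonneg'.1 (hneg.trans hcd))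
  have hle : (2 * d)⁻¹ • (x + d • p) ≤ p := by
    rw [inv_smul_le_iff_of_pos hd, two_mul, add_smul d d]
    exact add_le_add_left (hx.trans hcd) _
  have hfix := h.map_of_le _ ⟨hnonneg, hle.trans hp.2⟩ hle
  rw [map_smul] at hfix
  have hsum := smul_right_injective A (inv_ne_zero hd.ne') hfix
  rwa [map_add, map_smul, h.map_focus, add_left_inj] at hsum

end Order

variable {A : Type*} [NormedAddCommGroup A] [NormedSpace ℝ A] [PartialOrder A]
  [IsOrderedAddMonoid A] [PosSMulMono ℝ A] {u p : A} {J : A →ₗ[ℝ] A}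

theorem norm_map_le (h : IsCompression u p J) (hA : IsOrderUnitSpace A u) (a : A) :
    ‖J a‖ ≤ ‖a‖ :=
  hA.norm_map_le h.positive (h.map_unit.trans_le h.focus_mem.2) a

theorem one_le_norm_focus (h : IsCompression u p J) (hA : IsOrderUnitSpace A u) (hp : p ≠ 0) :
    1 ≤ ‖p‖ := by
  have hle : p ≤ ‖p‖ • p := by simpa [h.map_focus, h.map_unit] using h.mono (hA.le_norm_smul p)
  have hnorm := hA.norm_le_of_nonneg_of_le h.focus_mem.1 hle
  rw [norm_smul, norm_norm] at hnorm
  exact le_of_mul_le_mul_right (by rwa [one_mul]) (norm_pos_iff.2 hp)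

end IsCompression

/-! ### Compressions of a JB-algebra -/

namespace IsJBProduct

section Algebra

variable {A : Type*} [NormedAddCommGroup A] [NormedSpace ℝ A] {u p : A} {m : A →ₗ[ℝ] A →ₗ[ℝ] A}

theorem mul_unit (hm : IsJBProduct u m) (a : A) : m a u = a := by rw [hm.comm, hm.unit_mul]

theorem continuous_mul_left (hm : IsJBProduct u m) (a : A) : Continuous (m a) :=
  AddMonoidHomClass.continuous_of_bound (m a) ‖a‖ (hm.norm_mul_le a)

theorem jordan_linearized (hm : IsJBProduct u m) (a b c : A) :
    (2 : ℝ) • m (m (m a c) b) a + m (m (m a a) b) c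
      = (2 : ℝ) • m (m a c) (m b a) + m (m a a) (m b c) := by
  have hadd := hm.jordan (a + c) b
  have hsub := hm.jordan (a - c) b
  have hc := hm.jordan c b
  simp only [map_add, map_sub, LinearMap.add_apply, LinearMap.sub_apply, hm.comm c a] at hadd hsub
  linear_combination (norm := module) (2⁻¹ : ℝ) • hadd - (2⁻¹ : ℝ) • hsub - hc

theorem peirce_cubic (hm : IsJBProduct u m) (hp : m p p = p) (x : A) :
    (2 : ℝ) • m p (m p (m p x)) - (3 : ℝ) • m p (m p x) + m p x = 0 := by
  have h := hm.jordan_linearized p p x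
  rw [hp, hp, hm.comm (m (m p x) p) p, hm.comm (m p x) p] at h
  linear_combination (norm := module) h

theorem mul_mul_self_of_mul_eq_self (hm : IsJBProduct u m) (hp : m p p = p) {x : A}
    (hx : m p x = x) : m p (m x x) = m x x := by
  have h := hm.jordan_linearized p x x
  rw [hp, hx, hm.comm x p, hx, hm.comm _ p] at h
  linear_combination (norm := module) h

theorem mul_self_compl (hm : IsJBProduct u m) (a : A) :
    m (u - a) (u - a) = u - (2 : ℝ) • a + m a a := by
  simp only [map_sub, LinearMap.sub_apply, hm.unit_mul, hm.mul_unit]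
  module

theorem compl_idempotent (hm : IsJBProduct u m) (hp : m p p = p) : m (u - p) (u - p) = u - p := by
  rw [hm.mul_self_compl, hp]
  module

theorem norm_mul_self_sub_mul_self_le (hm : IsJBProduct u m) (x y : A) :
    ‖m x x - m y y‖ ≤ (‖x‖ + ‖y‖) * ‖x - y‖ := by
  have hfactor : m x x - m y y = m (x + y) (x - y) := by
    simp only [map_add, map_sub, LinearMap.add_apply, hm.comm y x]
    abel
  rw [hfactor]
  exact (hm.norm_mul_le _ _).trans (by gcongr; exact norm_add_le x y)

/-- The equation for `z` says that `(p - z)² = p - w`. -/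
theorem exists_eq_half_smul_add_mul_self (hm : IsJBProduct u m) (hp : m p p = p) {w : A}
    (hw : m p w = w) (hlt : ‖w‖ < 1) : ∃ z, m p z = z ∧ z = (2⁻¹ : ℝ) • (w + m z z) := by
  have := hm.complete
  set s : Set A := Metric.closedBall 0 ‖w‖ ∩ {z | m p z = z}
  have hs : IsComplete s :=
    (Metric.isClosed_closedBall.inter
      (isClosed_eq (hm.continuous_mul_left p) continuous_id)).isComplete
  let f : A → A := fun z => (2⁻¹ : ℝ) • (w + m z z)
  have hmaps : Set.MapsTo f s s := by
    rintro z ⟨hz, hpz : m p z = z⟩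
    refine ⟨?_, ?_⟩
    · rw [mem_closedBall_zero_iff] at hz ⊢
      have hle : ‖w + m z z‖ ≤ ‖w‖ + ‖z‖ * ‖z‖ :=
        (norm_add_le _ _).trans (by gcongr; exact hm.norm_mul_le z z)
      rw [norm_smul, Real.norm_of_nonneg (by norm_num)]
      nlinarith [norm_nonneg z]
    · change m p (f z) = f z
      rw [map_smul, map_add, hw, hm.mul_mul_self_of_mul_eq_self hp hpz]
  have hcontr : ContractingWith ⟨‖w‖, norm_nonneg w⟩ (hmaps.restrict f s s) := by
    refine ⟨hlt, LipschitzWith.of_dist_le_mul ?_⟩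
    rintro ⟨x, hx, -⟩ ⟨y, hy, -⟩
    rw [mem_closedBall_zero_iff] at hx hy
    change dist (f x) (f y) ≤ ‖w‖ * dist x y
    have hdiff := hm.norm_mul_self_sub_mul_self_le x y
    rw [dist_eq_norm, dist_eq_norm, ← smul_sub, add_sub_add_left_eq_sub, norm_smul,
      Real.norm_of_nonneg (by norm_num)]
    nlinarith [norm_nonneg (x - y)]
  have hzero : (0 : A) ∈ s := ⟨by simp, by simp⟩
  obtain ⟨z, hz, hfix, -⟩ := hcontr.exists_fixedPoint' hs hmaps hzero (edist_ne_top _ _)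
  exact ⟨z, hz.2, hfix.symm⟩

theorem exists_mul_self_eq_smul_sub (hm : IsJBProduct u m) (hp : m p p = p) {x : A}
    (hx : m p x = x) {c : ℝ} (hc : ‖x‖ < c) : ∃ b, m b b = c • p - x := by
  have hc0 : 0 < c := (norm_nonneg x).trans_lt hc
  obtain ⟨z, hpz, hz⟩ := hm.exists_eq_half_smul_add_mul_self hp (w := c⁻¹ • x)
    (by rw [map_smul, hx])
    (by rwa [norm_smul, norm_inv, Real.norm_of_nonneg hc0.le, inv_mul_lt_one₀ hc0])
  have hzz : m z z = (2 : ℝ) • z - c⁻¹ • x := by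
    linear_combination (norm := module) (-2 : ℝ) • hz
  have hsq : m (p - z) (p - z) = p - c⁻¹ • x := by
    simp only [map_sub, LinearMap.sub_apply, hp, hpz, hm.comm z p, hzz]
    module
  refine ⟨√c • (p - z), ?_⟩
  rw [map_smul, map_smul, LinearMap.smul_apply, smul_smul, Real.mul_self_sqrt hc0.le, hsq,
    smul_sub, smul_inv_smul₀ hc0.ne']

end Algebra

variable {A : Type*} [NormedAddCommGroup A] [NormedSpace ℝ A] [PartialOrder A]
  [IsOrderedAddMonoid A] [PosSMulMono ℝ A] {u p : A} {m : A →ₗ[ℝ] A →ₗ[ℝ] A} {J : A →ₗ[ℝ] A}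

theorem mul_self_nonneg (hm : IsJBProduct u m) (hA : IsOrderUnitSpace A u) (a : A) :
    0 ≤ m a a := by
  obtain ⟨b, hb⟩ := hm.exists_mul_self_eq_smul_sub (hm.unit_mul u) (hm.unit_mul (m a a))
    (lt_add_one ‖m a a‖)
  set c := ‖m a a‖ + 1
  have hc : 0 ≤ c := by positivity
  have hnorm : ‖m b b‖ ≤ c := calc
    ‖m b b‖ ≤ ‖m b b + m a a‖ := hm.norm_sq_le b a
    _ = c * ‖u‖ := by rw [hb, sub_add_cancel, norm_smul, Real.norm_of_nonneg hc]
    _ ≤ c := mul_le_of_le_one_right hc hA.norm_unit_le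
  have hle := hA.le_smul_of_norm_le hnorm
  rwa [hb, sub_le_self_iff] at hle

theorem le_smul_of_mul_eq_self (hm : IsJBProduct u m) (hA : IsOrderUnitSpace A u)
    (hp : m p p = p) {x : A} (hx : m p x = x) {c : ℝ} (hc : ‖x‖ < c) : x ≤ c • p := by
  obtain ⟨b, hb⟩ := hm.exists_mul_self_eq_smul_sub hp hx hc
  rw [← sub_nonneg, ← hb]
  exact hm.mul_self_nonneg hA b

theorem mul_self_le (hm : IsJBProduct u m) (hA : IsOrderUnitSpace A u) {e : A}
    (he : e ∈ unitEffects u) : m e e ≤ e := by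
  have hnorm : ‖u - (2 : ℝ) • e‖ ≤ 1 := by
    refine hA.norm_le_of_le zero_le_one ?_ ?_
    · rw [one_smul]
      exact sub_le_self _ (smul_nonneg zero_le_two he.1)
    · rw [one_smul, neg_sub, sub_le_iff_le_add, two_smul]
      exact add_le_add he.2 he.2
  have hsq : m (u - (2 : ℝ) • e) (u - (2 : ℝ) • e) ≤ (1 : ℝ) • u :=
    hA.le_smul_of_norm_le (by rw [hm.norm_sq]; exact pow_le_one₀ (norm_nonneg _) hnorm)
  have hdiff : (1 : ℝ) • u - m (u - (2 : ℝ) • e) (u - (2 : ℝ) • e) = (4 : ℝ) • (e - m e e) := by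
    simp only [hm.mul_self_compl, map_smul, LinearMap.smul_apply]
    module
  rwa [← sub_nonneg, hdiff, smul_nonneg_iff_nonneg_of_pos_left (by norm_num), sub_nonneg] at hsq

theorem focus_idempotent (hm : IsJBProduct u m) (hA : IsOrderUnitSpace A u)
    (hJ : IsCompression u p J) : m p p = p := by
  have hnonneg : 0 ≤ p - m p p := sub_nonneg.2 (hm.mul_self_le hA hJ.focus_mem)
  have hle_focus : p - m p p ≤ p := sub_le_self _ (hm.mul_self_nonneg hA p)
  have hle_compl : p - m p p ≤ u - p := by
    have h := hm.mul_self_nonneg hA (u - p)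
    rw [hm.mul_self_compl] at h
    rw [← sub_nonneg]
    convert h using 1
    module
  have hfix := hJ.map_of_le _ ⟨hnonneg, hle_focus.trans hJ.focus_mem.2⟩ hle_focus
  have hnonpos := hJ.mono hle_compl
  rw [hfix, hJ.map_compl] at hnonpos
  exact (sub_eq_zero.1 (hnonpos.antisymm hnonneg)).symm

theorem map_nonneg_of_mul_eq_half (hm : IsJBProduct u m) (hA : IsOrderUnitSpace A u)
    (hJ : IsCompression u p J) {a : A} (ha : m p a = (2⁻¹ : ℝ) • a) : 0 ≤ J a := by
  have hq := hm.compl_idempotent (hm.focus_idempotent hA hJ)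
  -- `J` annihilates the constant term of `(u - p + t a)² = (u - p) + t a + t² a²`.
  refine hA.nonneg_of_forall_add_smul_nonneg (b := J (m a a)) fun t ht => ?_
  have hsq : m (u - p + t • a) (u - p + t • a) = u - p + t • (a + t • m a a) := by
    rw [map_add, map_add, LinearMap.add_apply, LinearMap.add_apply, hq, hm.comm (t • a) (u - p)]
    simp only [map_sub, map_smul, LinearMap.sub_apply, LinearMap.smul_apply, hm.unit_mul, ha]
    module
  have h := hJ.positive _ (hm.mul_self_nonneg hA (u - p + t • a))
  rwa [hsq, map_add, hJ.map_compl, zero_add, map_smul, smul_nonneg_iff_nonneg_of_pos_left ht,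
    map_add, map_smul] at h

theorem map_eq_zero_of_mul_eq_half (hm : IsJBProduct u m) (hA : IsOrderUnitSpace A u)
    (hJ : IsCompression u p J) {a : A} (ha : m p a = (2⁻¹ : ℝ) • a) : J a = 0 := by
  have hneg := hm.map_nonneg_of_mul_eq_half hA hJ (a := -a) (by rw [map_neg, ha, smul_neg])
  rw [map_neg, neg_nonneg] at hneg
  exact hneg.antisymm (hm.map_nonneg_of_mul_eq_half hA hJ ha)

theorem compression_apply (hm : IsJBProduct u m) (hA : IsOrderUnitSpace A u)
    (hJ : IsCompression u p J) (x : A) : J x = (2 : ℝ) • m p (m p x) - m p x := by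
  have hp := hm.focus_idempotent hA hJ
  have hq := hm.compl_idempotent hp
  have hcubic := hm.peirce_cubic hp x
  set x₁ := (2 : ℝ) • m p (m p x) - m p x with hx₁
  set x₂ := (4 : ℝ) • (m p x - m p (m p x)) with hx₂
  set x₀ := x - (3 : ℝ) • m p x + (2 : ℝ) • m p (m p x) with hx₀
  have hsum : x = x₁ + x₂ + x₀ := by rw [hx₁, hx₂, hx₀]; module
  have hmul₁ : m p x₁ = x₁ := by
    simp only [hx₁, map_sub, map_smul]
    linear_combination (norm := module) hcubic
  have hmul₂ : m p x₂ = (2⁻¹ : ℝ) • x₂ := by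
    simp only [hx₂, map_sub, map_smul]
    linear_combination (norm := module) (-2 : ℝ) • hcubic
  have hmul₀ : m (u - p) x₀ = x₀ := by
    simp only [hx₀, map_sub, map_add, LinearMap.sub_apply, hm.unit_mul, map_smul]
    linear_combination (norm := module) -hcubic
  have hJ₁ : J x₁ = x₁ := hJ.map_eq_self_of_le_smul
    (hm.le_smul_of_mul_eq_self hA hp hmul₁ (lt_add_one _))
    (hm.le_smul_of_mul_eq_self hA hp (by rw [map_neg, hmul₁]) (by simp))
  have hJ₀ : J x₀ = 0 := hJ.map_eq_zero_of_le_smul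
    (hm.le_smul_of_mul_eq_self hA hq hmul₀ (lt_add_one _))
    (hm.le_smul_of_mul_eq_self hA hq (by rw [map_neg, hmul₀]) (by simp))
  rw [hsum, map_add, map_add, hJ₁, hm.map_eq_zero_of_mul_eq_half hA hJ hmul₂, hJ₀, add_zero,
    add_zero]

theorem mul_eq_multOp (hm : IsJBProduct u m) (hA : IsOrderUnitSpace A u) {P : Set A}
    {J : A → A →ₗ[ℝ] A} (hJ : IsCompressionBase u P J) (hp : p ∈ P) (a : A) :
    m p a = multOp u J p a := by
  have hJp := hm.compression_apply hA (hJ.compression p hp) a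
  have hJq := hm.compression_apply hA
    (hJ.compression (u - p) (hJ.normalSubalgebra.compl_mem p hp)) a
  simp only [map_sub, LinearMap.sub_apply, hm.unit_mul] at hJq
  simp only [multOp, LinearMap.smul_apply, LinearMap.sub_apply, LinearMap.add_apply,
    LinearMap.id_apply, hJp, hJq]
  module

end IsJBProduct

/-! ### Compression bases -/

theorem mem_commutantOf_compl {A : Type*} [AddCommGroup A] [Module ℝ A] {u p a : A}
    {J : A → A →ₗ[ℝ] A} : a ∈ commutantOf u J (u - p) ↔ a ∈ commutantOf u J p := by
  simp only [commutantOf, Set.mem_ofPred_eq, sub_sub_cancel, add_comm]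

theorem multOp_apply {A : Type*} [AddCommGroup A] [Module ℝ A] {u : A} {J : A → A →ₗ[ℝ] A}
    (p x : A) : multOp u J p x = (2⁻¹ : ℝ) • (x + J p x - J (u - p) x) := rfl

namespace IsCompressionBase

section Order

variable {A : Type*} [AddCommGroup A] [Module ℝ A] [PartialOrder A] {u p q a : A} {P : Set A}
  {J : A → A →ₗ[ℝ] A}

theorem compl_mem (h : IsCompressionBase u P J) (hp : p ∈ P) : u - p ∈ P :=
  h.normalSubalgebra.compl_mem p hp

theorem unit_mem (h : IsCompressionBase u P J) : u ∈ P := h.normalSubalgebra.unit_mem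

theorem zero_mem (h : IsCompressionBase u P J) : (0 : A) ∈ P := by
  simpa using h.compl_mem h.unit_mem

theorem nonneg (h : IsCompressionBase u P J) (hp : p ∈ P) : 0 ≤ p :=
  (h.normalSubalgebra.subset hp).1

theorem le_unit (h : IsCompressionBase u P J) (hp : p ∈ P) : p ≤ u :=
  (h.normalSubalgebra.subset hp).2

theorem map_unit (h : IsCompressionBase u P J) (hp : p ∈ P) : J p u = p :=
  (h.compression p hp).map_unit

theorem map_nonneg (h : IsCompressionBase u P J) (hp : p ∈ P) (hq : q ∈ P) : 0 ≤ J p q :=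
  (h.compression p hp).positive q (h.nonneg hq)

theorem sub_smul_mem_commutantOf_iff (h : IsCompressionBase u P J) (hp : p ∈ P) (t : ℝ) :
    a - t • u ∈ commutantOf u J p ↔ a ∈ commutantOf u J p := by
  simp only [commutantOf, Set.mem_ofPred_eq, map_sub, map_smul, h.map_unit hp,
    h.map_unit (h.compl_mem hp)]
  rw [sub_add_sub_comm, ← smul_add, add_sub_cancel, sub_left_inj]

theorem multOp_unit (h : IsCompressionBase u P J) (hp : p ∈ P) : multOp u J p u = p := by
  rw [multOp_apply, h.map_unit hp, h.map_unit (h.compl_mem hp)]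
  module

theorem multOp_self (h : IsCompressionBase u P J) (hp : p ∈ P) : multOp u J p p = p := by
  have hcompl := (h.compression _ (h.compl_mem hp)).map_compl
  rw [sub_sub_cancel] at hcompl
  rw [multOp_apply, hcompl, (h.compression p hp).map_focus]
  module

theorem multOp_comm_iff (h : IsCompressionBase u P J) (hp : p ∈ P) (hq : q ∈ P) :
    multOp u J p q = multOp u J q p ↔
      J p q + J (u - p) (u - q) = J q p + J (u - q) (u - p) := by
  rw [multOp_apply, multOp_apply, (smul_right_injective A (by norm_num : (2⁻¹ : ℝ) ≠ 0)).eq_iff,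
    map_sub (J (u - p)), map_sub (J (u - q)), h.map_unit (h.compl_mem hp),
    h.map_unit (h.compl_mem hq)]
  constructor <;> intro e <;> linear_combination (norm := module) e

variable [IsOrderedAddMonoid A]

theorem sub_mem (h : IsCompressionBase u P J) (hp : p ∈ P) (hq : q ∈ P) (hpq : p ≤ q) :
    q - p ∈ P := by
  have hmem := h.compl_mem (h.normalSubalgebra.add_mem p hp (u - q) (h.compl_mem hq)
    (by rwa [add_sub_left_comm, add_le_iff_nonpos_right, sub_nonpos]))
  rwa [← sub_sub, sub_sub, add_comm, ← sub_sub, sub_sub_cancel] at hmem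

theorem map_le_focus (h : IsCompressionBase u P J) (hp : p ∈ P) (hq : q ∈ P) : J p q ≤ p :=
  ((h.compression p hp).mono (h.le_unit hq)).trans_eq (h.map_unit hp)

/-- Such an `r` is the meet of `p` and `q`. -/
theorem map_map (h : IsCompressionBase u P J) {r : A} (hp : p ∈ P) (hq : q ∈ P) (hr : r ∈ P)
    (hrp : r ≤ p) (hrq : r ≤ q) (hsum : p + q ≤ u + r) (x : A) : J p (J q x) = J r x := by
  have hcomp := h.comp_eq (p - r) (h.sub_mem hr hp hrp) (q - r) (h.sub_mem hr hq hrq) r hr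
    (by rwa [add_assoc, sub_add_cancel, sub_add_eq_add_sub, sub_le_iff_le_add])
  rw [sub_add_cancel, sub_add_cancel] at hcomp
  exact LinearMap.congr_fun hcomp x

theorem map_map_of_le (h : IsCompressionBase u P J) (hp : p ∈ P) (hq : q ∈ P) (hpq : p ≤ q)
    (x : A) : J p (J q x) = J p x :=
  h.map_map hp hq hp le_rfl hpq (by rw [add_comm]; gcongr; exact h.le_unit hq) x

theorem map_map_of_ge (h : IsCompressionBase u P J) (hp : p ∈ P) (hq : q ∈ P) (hqp : q ≤ p)
    (x : A) : J p (J q x) = J q x :=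
  h.map_map hp hq hq hqp le_rfl (by gcongr; exact h.le_unit hp) x

theorem map_le_of_mem_commutantOf (h : IsCompressionBase u P J) (hp : p ∈ P) (hq : q ∈ P)
    (hcomm : q ∈ commutantOf u J p) : J p q ≤ q :=
  (le_add_of_nonneg_right (h.map_nonneg (h.compl_mem hp) hq)).trans_eq hcomm.symm

theorem add_le_of_mem_commutantOf (h : IsCompressionBase u P J) (hp : p ∈ P) (hq : q ∈ P)
    (hcomm : q ∈ commutantOf u J p) : p + q ≤ u + J p q := calc
  p + q = p + (J p q + J (u - p) q) := congrArg (p + ·) hcomm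
  _ ≤ p + (J p q + (u - p)) := by gcongr; exact h.map_le_focus (h.compl_mem hp) hq
  _ = u + J p q := by abel

theorem map_mem_of_mem_commutantOf (h : IsCompressionBase u P J) (hp : p ∈ P) (hq : q ∈ P)
    (hcomm : q ∈ commutantOf u J p) : J p q ∈ P := by
  have hnonneg := h.map_nonneg hp hq
  have hle_p := h.map_le_focus hp hq
  have hle_q := h.map_le_of_mem_commutantOf hp hq hcomm
  refine h.normalSubalgebra.normal _ ⟨hnonneg, hle_p.trans (h.le_unit hp)⟩
    (p - J p q) ⟨sub_nonneg.2 hle_p, (sub_le_self _ hnonneg).trans (h.le_unit hp)⟩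
    (q - J p q) ⟨sub_nonneg.2 hle_q, (sub_le_self _ hnonneg).trans (h.le_unit hq)⟩ ?_ ?_ ?_
  · rw [add_sub_cancel, ← add_sub_assoc, sub_le_iff_le_add]
    exact h.add_le_of_mem_commutantOf hp hq hcomm
  · rwa [add_sub_cancel]
  · rwa [add_sub_cancel]

theorem map_map_of_mem_commutantOf (h : IsCompressionBase u P J) (hp : p ∈ P) (hq : q ∈ P)
    (hcomm : q ∈ commutantOf u J p) (x : A) :
    J p (J q x) = J (J p q) x ∧ J q (J p x) = J (J p q) x := by
  have hmem := h.map_mem_of_mem_commutantOf hp hq hcomm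
  have hle_p := h.map_le_focus hp hq
  have hle_q := h.map_le_of_mem_commutantOf hp hq hcomm
  have hsum := h.add_le_of_mem_commutantOf hp hq hcomm
  exact ⟨h.map_map hp hq hmem hle_p hle_q hsum x,
    h.map_map hq hp hmem hle_q hle_p (by rwa [add_comm]) x⟩

theorem mem_commutantOf_map (h : IsCompressionBase u P J) (hp : p ∈ P) (hq : q ∈ P)
    (hcomm : q ∈ commutantOf u J p) (hap : a ∈ commutantOf u J p) (haq : a ∈ commutantOf u J q) :
    a ∈ commutantOf u J (J p q) := by
  have hx := h.map_mem_of_mem_commutantOf hp hq hcomm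
  have hxp := h.map_le_focus hp hq
  have hxq := h.map_le_of_mem_commutantOf hp hq hcomm
  have hsum := h.add_le_of_mem_commutantOf hp hq hcomm
  have hmap (y : A) : J p (J q y) = J (J p q) y := (h.map_map_of_mem_commutantOf hp hq hcomm y).1
  generalize J p q = x at *
  have hz := h.sub_mem hx hp hxp
  have hmap_compl : J p (J (u - q) a) = J (p - x) a :=
    h.map_map hp (h.compl_mem hq) hz (sub_le_self _ (h.nonneg hx))
      (by rwa [le_sub_iff_add_le, sub_add_eq_add_sub, sub_le_iff_le_add])
      (by rw [add_sub_left_comm, ← sub_nonneg]; simpa using hxq) a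
  have hJp : J p a = J x a + J (p - x) a := calc
    J p a = J p (J q a + J (u - q) a) := congrArg (J p) haq
    _ = J x a + J (p - x) a := by rw [map_add, hmap, hmap_compl]
  have hJx : J (u - x) a = J (p - x) a + J (u - p) a := calc
    J (u - x) a = J (u - x) (J p a + J (u - p) a) := congrArg (J (u - x)) hap
    _ = J (p - x) a + J (u - p) a := by
      rw [map_add, h.map_map (h.compl_mem hx) hp hz (sub_le_sub_right (h.le_unit hp) x)
        (sub_le_self _ (h.nonneg hx)) (by rw [sub_add_eq_add_sub, add_sub_assoc]),
        h.map_map_of_ge (h.compl_mem hx) (h.compl_mem hp) (sub_le_sub_left hxp u)]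
  calc a = J p a + J (u - p) a := hap
    _ = J x a + J (u - x) a := by rw [hJp, hJx, add_assoc]

theorem map_eq_zero_of_add_le (h : IsCompressionBase u P J) (hp : p ∈ P) (hq : q ∈ P)
    (hpq : p + q ≤ u) : J p q = 0 := by
  have hle := (h.compression p hp).mono (le_sub_iff_add_le'.2 hpq)
  rw [(h.compression p hp).map_compl] at hle
  exact hle.antisymm (h.map_nonneg hp hq)

theorem multOp_of_add_le (h : IsCompressionBase u P J) (hp : p ∈ P) (hq : q ∈ P)
    (hpq : p + q ≤ u) : multOp u J p q = 0 := by
  have hfix : J (u - p) q = q := (h.compression _ (h.compl_mem hp)).map_of_le q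
    (h.normalSubalgebra.subset hq) (le_sub_iff_add_le'.2 hpq)
  rw [multOp_apply, h.map_eq_zero_of_add_le hp hq hpq, hfix, add_zero, sub_self, smul_zero]

end Order

variable {A : Type*} [NormedAddCommGroup A] [NormedSpace ℝ A] [PartialOrder A]
  [IsOrderedAddMonoid A] [PosSMulMono ℝ A] {u p q : A} {P : Set A} {J : A → A →ₗ[ℝ] A}

theorem map_unit_apply (h : IsCompressionBase u P J) (hA : IsOrderUnitSpace A u) (x : A) :
    J u x = x :=
  (h.compression u h.unit_mem).map_eq_self_of_le_smul (hA.le_norm_smul x) (hA.neg_le_norm_smul x)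

theorem map_zero_apply (h : IsCompressionBase u P J) (hA : IsOrderUnitSpace A u) (x : A) :
    J 0 x = 0 :=
  (h.compression 0 h.zero_mem).map_eq_zero_of_le_smul (c := ‖x‖)
    (by simpa using hA.le_norm_smul x) (by simpa using hA.neg_le_norm_smul x)

theorem map_map_of_add_le (h : IsCompressionBase u P J) (hA : IsOrderUnitSpace A u)
    (hp : p ∈ P) (hq : q ∈ P) (hpq : p + q ≤ u) (x : A) : J p (J q x) = 0 := by
  rw [h.map_map hp hq h.zero_mem (h.nonneg hp) (h.nonneg hq) (by rwa [add_zero]),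
    h.map_zero_apply hA]

theorem norm_multOp_le (h : IsCompressionBase u P J) (hA : IsOrderUnitSpace A u) (hp : p ∈ P)
    (x : A) : ‖multOp u J p x‖ ≤ 2 * ‖x‖ := by
  have hJp := (h.compression p hp).norm_map_le hA x
  have hJq := (h.compression _ (h.compl_mem hp)).norm_map_le hA x
  rw [multOp_apply, norm_smul, Real.norm_of_nonneg (by norm_num)]
  linarith [norm_sub_le (x + J p x) (J (u - p) x), norm_add_le x (J p x), norm_nonneg x]

theorem multOp_comm_of_add_le (h : IsCompressionBase u P J) (hA : IsOrderUnitSpace A u)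
    (hp : p ∈ P) (hq : q ∈ P) (hpq : p + q ≤ u) (x : A) :
    multOp u J p (multOp u J q x) = multOp u J q (multOp u J p x) := by
  have hp' := h.compl_mem hp
  have hq' := h.compl_mem hq
  have hqp : q + p ≤ u := by rwa [add_comm]
  have hr := h.compl_mem (h.normalSubalgebra.add_mem p hp q hq hpq)
  have hrp : u - (p + q) ≤ u - p := sub_le_sub_left (le_add_of_nonneg_right (h.nonneg hq)) u
  have hrq : u - (p + q) ≤ u - q := sub_le_sub_left (le_add_of_nonneg_left (h.nonneg hp)) u
  have hcompl (y : A) : J (u - p) (J (u - q) y) = J (u - (p + q)) y :=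
    h.map_map hp' hq' hr hrp hrq (le_of_eq (by abel)) y
  have hcompl' (y : A) : J (u - q) (J (u - p) y) = J (u - (p + q)) y :=
    h.map_map hq' hp' hr hrq hrp (le_of_eq (by abel)) y
  simp only [multOp_apply, map_smul, map_add, map_sub, h.map_map_of_add_le hA hp hq hpq,
    h.map_map_of_add_le hA hq hp hqp, h.map_map_of_le hp hq' (le_sub_iff_add_le.2 hpq),
    h.map_map_of_ge hq' hp (le_sub_iff_add_le.2 hpq),
    h.map_map_of_le hq hp' (le_sub_iff_add_le.2 hqp),
    h.map_map_of_ge hp' hq (le_sub_iff_add_le.2 hqp), hcompl, hcompl']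
  module

end IsCompressionBase

/-! ### Spectral approximation -/

/-- A decomposition of `d` into finitely many nonzero projections in `P`. For `d ≤ u` these are
automatically orthogonal, hence distinct, so that a finite set of projections suffices to encode
the family. -/
structure IsProjPartition {A : Type*} [AddCommMonoid A] (P : Set A) (d : A) (S : Finset A) :
    Prop where
  mem : ∀ p ∈ S, p ∈ P
  zero_notMem : (0 : A) ∉ S
  sum_eq : ∑ p ∈ S, p = d

/-- The elements supported by `d` with finite spectrum: the linear combinations of the members of a
partition of `d` into projections in `P`. -/
def simpleElements {A : Type*} [AddCommMonoid A] [Module ℝ A] (P : Set A) (d : A) : Set A :=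
  {a | ∃ (S : Finset A) (α : A → ℝ), IsProjPartition P d S ∧ a = ∑ p ∈ S, α p • p}

theorem smul_mem_simpleElements {A : Type*} [AddCommGroup A] [Module ℝ A] {P : Set A} {d : A}
    (hd : d ∈ P) (t : ℝ) : t • d ∈ simpleElements P d := by
  rcases eq_or_ne d 0 with rfl | hd0
  · exact ⟨∅, 0, ⟨by simp, by simp, by simp⟩, by simp⟩
  · exact ⟨{d}, fun _ => t, ⟨by simpa using hd, by simpa using hd0.symm, by simp⟩, by simp⟩

namespace IsCompressionBase

section Order

variable {A : Type*} [AddCommGroup A] [Module ℝ A] [PartialOrder A] [IsOrderedAddMonoid A]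
  {u d d₁ d₂ a : A} {P : Set A} {J : A → A →ₗ[ℝ] A}

theorem eq_zero_of_add_self_le (h : IsCompressionBase u P J) {p : A} (hp : p ∈ P)
    (hpp : p + p ≤ u) : p = 0 := by
  rw [← h.multOp_self hp, h.multOp_of_add_le hp hp hpp]

theorem add_mem_simpleElements (h : IsCompressionBase u P J) (hd : d₁ + d₂ ≤ u) {s₁ s₂ : A}
    (hs₁ : s₁ ∈ simpleElements P d₁) (hs₂ : s₂ ∈ simpleElements P d₂) :
    s₁ + s₂ ∈ simpleElements P (d₁ + d₂) := by
  classical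
  obtain ⟨S₁, α₁, hS₁, rfl⟩ := hs₁
  obtain ⟨S₂, α₂, hS₂, rfl⟩ := hs₂
  have hdisj : Disjoint S₁ S₂ := Finset.disjoint_left.2 fun p hp₁ hp₂ => by
    have hle₁ := Finset.single_le_sum (fun q hq => h.nonneg (hS₁.mem q hq)) hp₁
    have hle₂ := Finset.single_le_sum (fun q hq => h.nonneg (hS₂.mem q hq)) hp₂
    rw [hS₁.sum_eq] at hle₁
    rw [hS₂.sum_eq] at hle₂
    have hzero := h.eq_zero_of_add_self_le (hS₁.mem p hp₁) ((add_le_add hle₁ hle₂).trans hd)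
    exact hS₁.zero_notMem (hzero ▸ hp₁)
  refine ⟨S₁ ∪ S₂, fun p => if p ∈ S₁ then α₁ p else α₂ p, ⟨?_, ?_, ?_⟩, ?_⟩
  · exact fun p hp => (Finset.mem_union.1 hp).elim (hS₁.mem p) (hS₂.mem p)
  · simpa using ⟨hS₁.zero_notMem, hS₂.zero_notMem⟩
  · rw [Finset.sum_union hdisj, hS₁.sum_eq, hS₂.sum_eq]
  · rw [Finset.sum_union hdisj]
    congr 1
    · exact Finset.sum_congr rfl fun p hp => by simp only [if_pos hp]
    · exact Finset.sum_congr rfl fun p hp => by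
        simp only [if_neg (Finset.disjoint_right.1 hdisj hp)]

theorem map_of_le (h : IsCompressionBase u P J) (hd₁ : d₁ ∈ P) (hd : d ∈ P) (hle : d₁ ≤ d) :
    J d₁ d = d₁ := by
  rw [← h.map_unit hd, h.map_map_of_le hd₁ hd hle, h.map_unit hd₁]

theorem smul_le_map_of_le (h : IsCompressionBase u P J) (hd₁ : d₁ ∈ P) (hd : d ∈ P)
    (hle : d₁ ≤ d) {t : ℝ} (ht : t • d ≤ J d a) : t • d₁ ≤ J d₁ a := by
  simpa [h.map_of_le hd₁ hd hle, h.map_map_of_le hd₁ hd hle] using (h.compression d₁ hd₁).mono ht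

theorem map_le_smul_of_le (h : IsCompressionBase u P J) (hd₁ : d₁ ∈ P) (hd : d ∈ P)
    (hle : d₁ ≤ d) {t : ℝ} (ht : J d a ≤ t • d) : J d₁ a ≤ t • d₁ := by
  simpa [h.map_of_le hd₁ hd hle, h.map_map_of_le hd₁ hd hle] using (h.compression d₁ hd₁).mono ht

theorem exists_split (h : IsCompressionBase u P J) (hcomp : HasComparability u P J)
    (hd : d ∈ P) (had : a ∈ commutantOf u J d) (t : ℝ) :
    ∃ d₁ ∈ P, ∃ d₂ ∈ P, d₁ + d₂ = d ∧ J d₁ a + J d₂ a = J d a ∧ a ∈ commutantOf u J d₂ ∧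
      J d₁ a ≤ t • d₁ ∧ t • d₂ ≤ J d₂ a := by
  obtain ⟨p, ⟨hp, hpcomm⟩, hneg, hpos⟩ := hcomp (a - t • u)
  have hp' := h.compl_mem hp
  have hap : a ∈ commutantOf u J p := (h.sub_smul_mem_commutantOf_iff hp t).1 (hpcomm _ (.inr rfl))
  have hdp : d ∈ commutantOf u J p :=
    hpcomm d (.inl ⟨hd, by rintro _ rfl; exact (h.sub_smul_mem_commutantOf_iff hd t).2 had⟩)
  have hdp' := mem_commutantOf_compl.2 hdp
  have h₁ := h.map_mem_of_mem_commutantOf hp' hd hdp'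
  have h₂ := h.map_mem_of_mem_commutantOf hp hd hdp
  have hmap₁ (y : A) : J d (J (u - p) y) = J (J (u - p) d) y :=
    (h.map_map_of_mem_commutantOf hp' hd hdp' y).2
  have hmap₂ (y : A) : J d (J p y) = J (J p d) y := (h.map_map_of_mem_commutantOf hp hd hdp y).2
  refine ⟨J (u - p) d, h₁, J p d, h₂, ?_, ?_, h.mem_commutantOf_map hp hd hdp hap had, ?_, ?_⟩
  · rw [add_comm]
    exact hdp.symm
  · rw [← hmap₁, ← hmap₂, ← map_add, add_comm]
    exact congrArg (J d) hap.symm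
  · have hle := (h.compression d hd).mono hneg
    rwa [hmap₁, map_zero, map_sub, map_smul, h.map_unit h₁, sub_nonpos] at hle
  · have hle := (h.compression d hd).positive _ hpos
    rwa [hmap₂, map_sub, map_smul, h.map_unit h₂, sub_nonneg] at hle

variable [PosSMulMono ℝ A]

theorem exists_simpleElement_le_map (h : IsCompressionBase u P J)
    (hcomp : HasComparability u P J) {ε : ℝ} (hε : 0 ≤ ε) (n : ℕ) (hd : d ∈ P)
    (had : a ∈ commutantOf u J d) {l : ℝ} (hl : l • d ≤ J d a) (hu : J d a ≤ (l + n * ε) • d) :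
    ∃ s ∈ simpleElements P d, s ≤ J d a ∧ J d a ≤ s + ε • d := by
  induction n generalizing d l with
  | zero =>
    refine ⟨l • d, smul_mem_simpleElements hd l, hl, hu.trans ?_⟩
    simpa using smul_nonneg hε (h.nonneg hd)
  | succ n ih =>
    obtain ⟨d₁, hd₁, d₂, hd₂, rfl, hJ, had₂, hu₁, hl₂⟩ := h.exists_split hcomp hd had (l + ε)
    have hle₁ : d₁ ≤ d₁ + d₂ := le_add_of_nonneg_right (h.nonneg hd₂)
    have hle₂ : d₂ ≤ d₁ + d₂ := le_add_of_nonneg_left (h.nonneg hd₁)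
    have hl₁ := h.smul_le_map_of_le hd₁ hd hle₁ hl
    have hu₂ := h.map_le_smul_of_le hd₂ hd hle₂ hu
    obtain ⟨s, hs, hsl, hsu⟩ := ih hd₂ had₂ hl₂ (hu₂.trans_eq (by push_cast; congr 1; ring))
    refine ⟨l • d₁ + s, h.add_mem_simpleElements (h.le_unit hd) (smul_mem_simpleElements hd₁ l) hs,
      (add_le_add hl₁ hsl).trans_eq hJ, ?_⟩
    calc J (d₁ + d₂) a = J d₁ a + J d₂ a := hJ.symm
      _ ≤ (l + ε) • d₁ + (s + ε • d₂) := add_le_add hu₁ hsu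
      _ = l • d₁ + s + ε • (d₁ + d₂) := by module

end Order

theorem dense_simpleElements {A : Type*} [NormedAddCommGroup A] [NormedSpace ℝ A]
    [PartialOrder A] [IsOrderedAddMonoid A] [PosSMulMono ℝ A] {u : A} {P : Set A}
    {J : A → A →ₗ[ℝ] A} (h : IsCompressionBase u P J) (hA : IsOrderUnitSpace A u)
    (hcomp : HasComparability u P J) : Dense (simpleElements P u) := by
  refine Metric.dense_iff.2 fun a r hr => ?_
  obtain ⟨n, hn⟩ := exists_nat_gt (2 * ‖a‖ / (r / 2))
  rw [div_lt_iff₀ (half_pos hr)] at hn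
  have hua := h.map_unit_apply hA a
  obtain ⟨s, hs, hsa, has⟩ := h.exists_simpleElement_le_map hcomp (a := a) (l := -‖a‖)
    (half_pos hr).le n h.unit_mem (by simp [commutantOf, hua, h.map_zero_apply hA])
    (by rw [hua, neg_smul]; exact neg_le.1 (hA.neg_le_norm_smul a))
    (by rw [hua]; exact hA.le_smul_of_norm_le (by linarith))
  rw [hua] at hsa has
  refine ⟨s, ?_, hs⟩
  rw [Metric.mem_ball, dist_eq_norm']
  refine (hA.norm_le_of_le (half_pos hr).le (sub_le_iff_le_add'.2 has) ?_).trans_lt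
    (half_lt_self hr)
  exact (neg_nonpos.2 (sub_nonneg.2 hsa)).trans (smul_nonneg (half_pos hr).le hA.unit_nonneg)

end IsCompressionBase

namespace IsProjPartition

section Order

variable {A : Type*} [AddCommGroup A] [Module ℝ A] [PartialOrder A] [IsOrderedAddMonoid A]
  {u p q : A} {P : Set A} {J : A → A →ₗ[ℝ] A} {S T : Finset A}

theorem sum_mem (hS : IsProjPartition P u S) (h : IsCompressionBase u P J) (hT : T ⊆ S) :
    ∑ p ∈ T, p ∈ P := by
  classical
  induction T using Finset.induction_on with
  | empty => simpa using h.zero_mem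
  | insert p T hp ih =>
    have hle : ∑ q ∈ insert p T, q ≤ u := hS.sum_eq ▸
      Finset.sum_le_sum_of_subset_of_nonneg hT fun q hq _ => h.nonneg (hS.mem q hq)
    rw [Finset.sum_insert hp] at hle ⊢
    exact h.normalSubalgebra.add_mem p (hS.mem p (hT (Finset.mem_insert_self p T))) _
      (ih ((Finset.subset_insert p T).trans hT)) hle

theorem add_le_unit (hS : IsProjPartition P u S) (h : IsCompressionBase u P J) (hp : p ∈ S)
    (hq : q ∈ S) (hpq : p ≠ q) : p + q ≤ u := by
  classical
  have hsub : {p, q} ⊆ S := by simp [Finset.insert_subset_iff, hp, hq]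
  simpa [Finset.sum_pair hpq] using h.le_unit (hS.sum_mem h hsub)

theorem map_sum_smul (hS : IsProjPartition P u S) (h : IsCompressionBase u P J) (α : A → ℝ)
    (hp : p ∈ S) : J p (∑ q ∈ S, α q • q) = α p • p := by
  rw [map_sum, Finset.sum_eq_single_of_mem p hp fun q hq hqp => ?_, map_smul,
    (h.compression p (hS.mem p hp)).map_focus]
  rw [map_smul, h.map_eq_zero_of_add_le (hS.mem p hp) (hS.mem q hq)
    (hS.add_le_unit h hp hq hqp.symm), smul_zero]

end Order

variable {A : Type*} [NormedAddCommGroup A] [NormedSpace ℝ A] [PartialOrder A]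
  [IsOrderedAddMonoid A] [PosSMulMono ℝ A] {u : A} {P : Set A} {J : A → A →ₗ[ℝ] A}
  {S : Finset A} {α : A → ℝ} {C : ℝ}

theorem sum_smul_le (hS : IsProjPartition P u S) (h : IsCompressionBase u P J)
    (hα : ∀ p ∈ S, α p ≤ C) : ∑ p ∈ S, α p • p ≤ C • u := by
  rw [← hS.sum_eq, Finset.smul_sum]
  exact Finset.sum_le_sum fun p hp =>
    smul_le_smul_of_nonneg_right (hα p hp) (h.nonneg (hS.mem p hp))

theorem norm_sum_smul_le_iff (hS : IsProjPartition P u S) (h : IsCompressionBase u P J)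
    (hA : IsOrderUnitSpace A u) (hC : 0 ≤ C) :
    ‖∑ p ∈ S, α p • p‖ ≤ C ↔ ∀ p ∈ S, |α p| ≤ C := by
  refine ⟨fun hle p hp => ?_, fun hα => hA.norm_le_of_le hC ?_ ?_⟩
  · have hcompr := h.compression p (hS.mem p hp)
    calc |α p| ≤ |α p| * ‖p‖ := le_mul_of_one_le_right (abs_nonneg _)
          (hcompr.one_le_norm_focus hA (ne_of_mem_of_not_mem hp hS.zero_notMem))
      _ = ‖J p (∑ q ∈ S, α q • q)‖ := by rw [hS.map_sum_smul h α hp, norm_smul, Real.norm_eq_abs]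
      _ ≤ C := (hcompr.norm_map_le hA _).trans hle
  · exact hS.sum_smul_le h fun p hp => (abs_le.1 (hα p hp)).2
  · simpa using hS.sum_smul_le h (α := -α) fun p hp => neg_le.1 (abs_le.1 (hα p hp)).1

end IsProjPartition

/-! ### Extending the multiplication operators to a product -/

theorem norm_sum_smul_le_of_subsums {E ι : Type*} [NormedAddCommGroup E] [NormedSpace ℝ E]
    {v : ι → E} {α : ι → ℝ} {I : Finset ι} {M C : ℝ} (hM : 0 ≤ M) (hα : ∀ i ∈ I, |α i| ≤ M)
    (hC : ∀ T ⊆ I, ‖∑ i ∈ T, v i‖ ≤ C) : ‖∑ i ∈ I, α i • v i‖ ≤ M * (2 * C) := by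
  classical
  obtain ⟨g, hg, hgx⟩ := exists_dual_vector'' ℝ (∑ i ∈ I, α i • v i)
  have hsub {T : Finset ι} (hT : T ⊆ I) : |∑ i ∈ T, g (v i)| ≤ C := by
    rw [← map_sum, ← Real.norm_eq_abs]
    exact (g.le_of_opNorm_le hg _).trans ((one_mul _).trans_le (hC T hT))
  have habs : ∑ i ∈ I, |g (v i)| ≤ 2 * C := by
    rw [← Finset.sum_filter_add_sum_filter_not I (fun i => 0 ≤ g (v i)),
      Finset.sum_congr rfl fun i hi => abs_of_nonneg (Finset.mem_filter.1 hi).2,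
      Finset.sum_congr rfl fun i hi => abs_of_nonpos (le_of_not_ge (Finset.mem_filter.1 hi).2),
      Finset.sum_neg_distrib]
    linarith [(abs_le.1 (hsub (I.filter_subset fun i => 0 ≤ g (v i)))).2,
      (abs_le.1 (hsub (I.filter_subset fun i => ¬ 0 ≤ g (v i)))).1]
  calc ‖∑ i ∈ I, α i • v i‖ = ∑ i ∈ I, α i * g (v i) := by simpa using hgx.symm
    _ ≤ ∑ i ∈ I, M * |g (v i)| := Finset.sum_le_sum fun i hi =>
        (le_abs_self _).trans (by rw [abs_mul]; gcongr; exact hα i hi)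
    _ ≤ M * (2 * C) := by rw [← Finset.mul_sum]; gcongr

/-- The linear span of the operators `T_p`, `p ∈ P`, among the bounded operators. When
`T_p q = T_q p` for all `p, q ∈ P`, evaluation at `u` embeds it densely in `A`, and the inverse of
this embedding is the multiplication. -/
def multOpSpan {A : Type*} [NormedAddCommGroup A] [NormedSpace ℝ A] (u : A) (P : Set A)
    (J : A → A →ₗ[ℝ] A) : Submodule ℝ (A →L[ℝ] A) :=
  Submodule.span ℝ {T | ∃ p ∈ P, ∀ x, T x = multOp u J p x}

/-- The bounded bilinear map `m` extends `(p, x) ↦ T_p x` from `P × A` to `A × A`. -/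
def ExtendsMultOp {A : Type*} [NormedAddCommGroup A] [NormedSpace ℝ A] (u : A) (P : Set A)
    (J : A → A →ₗ[ℝ] A) (m : A →L[ℝ] A →L[ℝ] A) : Prop :=
  ∀ p ∈ P, ∀ x, m p x = multOp u J p x

namespace IsCompressionBase

variable {A : Type*} [NormedAddCommGroup A] [NormedSpace ℝ A] [PartialOrder A] {u q : A}
  {P : Set A} {J : A → A →ₗ[ℝ] A} {T : A →L[ℝ] A}

theorem multOpSpan_apply (h : IsCompressionBase u P J)
    (hsymm : ∀ p ∈ P, ∀ q ∈ P, multOp u J p q = multOp u J q p) (hT : T ∈ multOpSpan u P J)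
    (hq : q ∈ P) : T q = multOp u J q (T u) := by
  induction hT using Submodule.span_induction with
  | mem T hT =>
    obtain ⟨p, hp, hTp⟩ := hT
    rw [hTp, hTp, h.multOp_unit hp, hsymm p hp q hq]
  | zero => simp
  | add T T' _ _ hT hT' => simp [hT, hT']
  | smul c T _ hT => simp [hT]

variable [IsOrderedAddMonoid A] [PosSMulMono ℝ A]

theorem dense_span (h : IsCompressionBase u P J) (hA : IsOrderUnitSpace A u)
    (hcomp : HasComparability u P J) : Dense (Submodule.span ℝ P : Set A) := by
  refine (h.dense_simpleElements hA hcomp).mono ?_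
  rintro _ ⟨S, α, hS, rfl⟩
  exact Submodule.sum_mem _ fun p hp =>
    Submodule.smul_mem _ _ (Submodule.subset_span (hS.mem p hp))

theorem norm_multOpSpan_apply_le (h : IsCompressionBase u P J) (hA : IsOrderUnitSpace A u)
    (hcomp : HasComparability u P J) (hsymm : ∀ p ∈ P, ∀ q ∈ P, multOp u J p q = multOp u J q p)
    (hT : T ∈ multOpSpan u P J) (b : A) : ‖T b‖ ≤ ‖b‖ * (2 * (2 * ‖T u‖)) := by
  have hclosed : IsClosed {b | ‖T b‖ ≤ ‖b‖ * (2 * (2 * ‖T u‖))} :=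
    isClosed_le (by fun_prop) (by fun_prop)
  refine (h.dense_simpleElements hA hcomp).induction ?_ hclosed b
  rintro _ ⟨S, α, hS, rfl⟩
  have hcoeff := (hS.norm_sum_smul_le_iff h hA (α := α) (norm_nonneg _)).1 le_rfl
  simp only [map_sum, map_smul]
  refine norm_sum_smul_le_of_subsums (norm_nonneg _) hcoeff fun S' hS' => ?_
  have hmem := hS.sum_mem h hS'
  rw [← map_sum, h.multOpSpan_apply hsymm hT hmem]
  exact h.norm_multOp_le hA hmem _

theorem exists_extendsMultOp [CompleteSpace A] (h : IsCompressionBase u P J)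
    (hA : IsOrderUnitSpace A u) (hcomp : HasComparability u P J)
    (hsymm : ∀ p ∈ P, ∀ q ∈ P, multOp u J p q = multOp u J q p) :
    ∃ m, ExtendsMultOp u P J m := by
  let f : multOpSpan u P J →ₗ[ℝ] A →L[ℝ] A := (multOpSpan u P J).subtype
  let e : multOpSpan u P J →ₗ[ℝ] A :=
    (ContinuousLinearMap.apply ℝ A u).toLinearMap ∘ₗ (multOpSpan u P J).subtype
  have hlift {p : A} (hp : p ∈ P) : ∃ T, e T = p ∧ ∀ x, f T x = multOp u J p x :=
    ⟨⟨(multOp u J p).mkContinuous 2 (h.norm_multOp_le hA hp),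
      Submodule.subset_span ⟨p, hp, fun _ => rfl⟩⟩, h.multOp_unit hp, fun _ => rfl⟩
  have hdense : DenseRange e := by
    refine (h.dense_span hA hcomp).mono ?_
    rw [← LinearMap.coe_range, SetLike.coe_subset_coe, Submodule.span_le]
    exact fun p hp => (hlift hp).imp fun T hT => hT.1
  have hbound : ∃ C, ∀ T, ‖f T‖ ≤ C * ‖e T‖ := by
    refine ⟨4, fun T => (f T).opNorm_le_bound (by positivity) fun b => ?_⟩
    refine (h.norm_multOpSpan_apply_le hA hcomp hsymm T.2 b).trans_eq ?_
    change ‖b‖ * (2 * (2 * ‖e T‖)) = _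
    ring
  refine ⟨f.extendOfNorm e, fun p hp x => ?_⟩
  obtain ⟨T, rfl, hT⟩ := hlift hp
  rw [LinearMap.extendOfNorm_eq hdense hbound, hT]

end IsCompressionBase

theorem IsProjPartition.extendsMultOp_mul_self {A : Type*} [NormedAddCommGroup A]
    [NormedSpace ℝ A] [PartialOrder A] [IsOrderedAddMonoid A] {u : A} {P : Set A}
    {J : A → A →ₗ[ℝ] A} {S : Finset A} {m : A →L[ℝ] A →L[ℝ] A} (hS : IsProjPartition P u S)
    (h : IsCompressionBase u P J) (hm : ExtendsMultOp u P J m) (α : A → ℝ) :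
    m (∑ p ∈ S, α p • p) (∑ p ∈ S, α p • p) = ∑ p ∈ S, (α p ^ 2) • p := by
  rw [map_sum m, sum_apply]
  refine Finset.sum_congr rfl fun p hp => ?_
  rw [map_smul, smul_apply, hm p (hS.mem p hp), map_sum,
    Finset.sum_eq_single_of_mem p hp fun q hq hqp => ?_]
  · rw [map_smul, h.multOp_self (hS.mem p hp), smul_smul, sq]
  · rw [map_smul, h.multOp_of_add_le (hS.mem p hp) (hS.mem q hq)
      (hS.add_le_unit h hp hq hqp.symm), smul_zero]

namespace ExtendsMultOp

variable {A : Type*} [NormedAddCommGroup A] [NormedSpace ℝ A] [PartialOrder A]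
  [IsOrderedAddMonoid A] [PosSMulMono ℝ A] {u : A} {P : Set A} {J : A → A →ₗ[ℝ] A}
  {m : A →L[ℝ] A →L[ℝ] A}

theorem mul_comm (hm : ExtendsMultOp u P J m) (h : IsCompressionBase u P J)
    (hA : IsOrderUnitSpace A u) (hcomp : HasComparability u P J)
    (hsymm : ∀ p ∈ P, ∀ q ∈ P, multOp u J p q = multOp u J q p) (a b : A) : m a b = m b a := by
  have hdense := h.dense_span hA hcomp
  have hflip : m = m.flip := ContinuousLinearMap.ext_on hdense fun p hp =>
    ContinuousLinearMap.ext_on hdense fun q hq => by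
      rw [ContinuousLinearMap.flip_apply, hm p hp, hm q hq, hsymm p hp q hq]
  exact congrArg (fun n : A →L[ℝ] A →L[ℝ] A => n a b) hflip

theorem unit_mul (hm : ExtendsMultOp u P J m) (h : IsCompressionBase u P J)
    (hA : IsOrderUnitSpace A u) (a : A) : m u a = a := by
  rw [hm u h.unit_mem, multOp_apply, sub_self, h.map_unit_apply hA, h.map_zero_apply hA]
  module

theorem mul_self_nonneg (hm : ExtendsMultOp u P J m) (h : IsCompressionBase u P J)
    (hA : IsOrderUnitSpace A u) (hcomp : HasComparability u P J) (a : A) : 0 ≤ m a a := by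
  have hclosed : IsClosed {a | 0 ≤ m a a} :=
    hA.isClosed_nonneg.preimage (by fun_prop : Continuous fun a => m a a)
  refine (h.dense_simpleElements hA hcomp).induction ?_ hclosed a
  rintro _ ⟨S, α, hS, rfl⟩
  rw [hS.extendsMultOp_mul_self h hm]
  exact Finset.sum_nonneg fun p hp => smul_nonneg (sq_nonneg _) (h.nonneg (hS.mem p hp))

theorem norm_mul_self (hm : ExtendsMultOp u P J m) (h : IsCompressionBase u P J)
    (hA : IsOrderUnitSpace A u) (hcomp : HasComparability u P J) (a : A) :
    ‖m a a‖ = ‖a‖ ^ 2 := by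
  have hclosed : IsClosed {a | ‖m a a‖ = ‖a‖ ^ 2} := isClosed_eq (by fun_prop) (by fun_prop)
  refine (h.dense_simpleElements hA hcomp).induction ?_ hclosed a
  rintro _ ⟨S, α, hS, rfl⟩
  have norm_le_iff {β : A → ℝ} {C : ℝ} (hC : 0 ≤ C) :=
    hS.norm_sum_smul_le_iff h hA (α := β) hC
  rw [hS.extendsMultOp_mul_self h hm]
  refine le_antisymm ?_ ?_
  · refine (norm_le_iff (by positivity)).2 fun p hp => ?_
    rw [abs_pow]
    exact pow_le_pow_left₀ (abs_nonneg _) ((norm_le_iff (norm_nonneg _)).1 le_rfl p hp) 2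
  · rw [← Real.le_sqrt (norm_nonneg _) (norm_nonneg _)]
    refine (norm_le_iff (Real.sqrt_nonneg _)).2 fun p hp => Real.le_sqrt_of_sq_le ?_
    rw [← abs_pow]
    exact (norm_le_iff (β := fun p => α p ^ 2) (norm_nonneg _)).1 le_rfl p hp

theorem commute_mul_self (hm : ExtendsMultOp u P J m) (h : IsCompressionBase u P J)
    (hA : IsOrderUnitSpace A u) (hcomp : HasComparability u P J) (a : A) :
    Commute (m a) (m (m a a)) := by
  have hclosed : IsClosed {a | m a * m (m a a) = m (m a a) * m a} :=
    isClosed_eq (by fun_prop) (by fun_prop)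
  refine (h.dense_simpleElements hA hcomp).induction ?_ hclosed a
  rintro _ ⟨S, α, hS, rfl⟩
  have hcommute : ∀ p ∈ S, ∀ q ∈ S, Commute (m p) (m q) := fun p hp q hq => by
    rcases eq_or_ne p q with rfl | hpq
    · exact Commute.refl _
    refine ContinuousLinearMap.ext fun x => ?_
    simp only [mul_apply_eq_comp, hm p (hS.mem p hp), hm q (hS.mem q hq)]
    exact h.multOp_comm_of_add_le hA (hS.mem p hp) (hS.mem q hq) (hS.add_le_unit h hp hq hpq) x
  rw [hS.extendsMultOp_mul_self h hm]
  simp only [map_sum, map_smul]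
  exact Commute.sum_left _ _ _ fun p hp => Commute.sum_right _ _ _ fun q hq =>
    ((hcommute p hp q hq).smul_left _).smul_right _

theorem norm_mul_le (hm : ExtendsMultOp u P J m) (h : IsCompressionBase u P J)
    (hA : IsOrderUnitSpace A u) (hcomp : HasComparability u P J)
    (hsymm : ∀ p ∈ P, ∀ q ∈ P, multOp u J p q = multOp u J q p) (a b : A) :
    ‖m a b‖ ≤ ‖a‖ * ‖b‖ := by
  have norm_mul_le_one {a b : A} (ha : ‖a‖ = 1) (hb : ‖b‖ = 1) : ‖m a b‖ ≤ 1 := by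
    have hpolar : (4 : ℝ) • m a b = m (a + b) (a + b) - m (a - b) (a - b) := by
      simp only [map_add, map_sub, add_apply, sub_apply,
        hm.mul_comm h hA hcomp hsymm b a]
      module
    have hmax := hA.norm_sub_le_max (hm.mul_self_nonneg h hA hcomp (a + b))
      (hm.mul_self_nonneg h hA hcomp (a - b))
    have hadd : ‖a + b‖ ≤ 2 := by linarith [norm_add_le a b]
    have hsub : ‖a - b‖ ≤ 2 := by linarith [norm_sub_le a b]
    rw [← hpolar, norm_smul, hm.norm_mul_self h hA hcomp, hm.norm_mul_self h hA hcomp,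
      Real.norm_ofNat] at hmax
    have hle : max (‖a + b‖ ^ 2) (‖a - b‖ ^ 2) ≤ 2 ^ 2 :=
      max_le (pow_le_pow_left₀ (norm_nonneg _) hadd 2) (pow_le_pow_left₀ (norm_nonneg _) hsub 2)
    linarith
  have hnorm : ‖m‖ ≤ 1 := ContinuousLinearMap.opNorm_le_of_unit_norm zero_le_one fun a ha =>
    ContinuousLinearMap.opNorm_le_of_unit_norm zero_le_one fun b hb => norm_mul_le_one ha hb
  simpa using m.le_of_opNorm₂_le_of_le hnorm (le_refl ‖a‖) (le_refl ‖b‖)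

theorem isJBProduct [CompleteSpace A] (hm : ExtendsMultOp u P J m)
    (h : IsCompressionBase u P J) (hA : IsOrderUnitSpace A u) (hcomp : HasComparability u P J)
    (hsymm : ∀ p ∈ P, ∀ q ∈ P, multOp u J p q = multOp u J q p) :
    IsJBProduct u (ContinuousLinearMap.coeLM ℝ ∘ₗ m.toLinearMap) where
  complete := inferInstance
  comm := hm.mul_comm h hA hcomp hsymm
  jordan a b := by
    have hcomm := hm.mul_comm h hA hcomp hsymm
    change m (m (m a a) b) a = m (m a a) (m b a)
    rw [hcomm _ a, hcomm b a]
    exact congrArg (fun T : A →L[ℝ] A => T b) (hm.commute_mul_self h hA hcomp a).eq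
  unit_mul := hm.unit_mul h hA
  norm_mul_le := hm.norm_mul_le h hA hcomp hsymm
  norm_sq := hm.norm_mul_self h hA hcomp
  norm_sq_le a b := hA.norm_le_of_nonneg_of_le (hm.mul_self_nonneg h hA hcomp a)
    (le_add_of_nonneg_right (hm.mul_self_nonneg h hA hcomp b))

end ExtendsMultOp

theorem theorem5p2 {A : Type*} [NormedAddCommGroup A] [NormedSpace ℝ A] [CompleteSpace A]
    [PartialOrder A] [IsOrderedAddMonoid A] [PosSMulMono ℝ A]
    (u : A) (hA : IsOrderUnitSpace A u)
    (P : Set A) (J : A → A →ₗ[ℝ] A)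
    (hJ : IsCompressionBase u P J) (hcomp : HasComparability u P J) :
    (IsJBAlgebra A u ↔
      ∀ p ∈ P, ∀ q ∈ P, J p q + J (u - p) (u - q) = J q p + J (u - q) (u - p)) ∧
    (IsJBAlgebra A u ↔
      ∀ p ∈ P, ∀ q ∈ P, multOp u J p q = multOp u J q p) ∧
    (∀ p ∈ P, ∀ q ∈ P,
      (J p q + J (u - p) (u - q) = J q p + J (u - q) (u - p) ↔
        multOp u J p q = multOp u J q p)) ∧
    (∀ m : A →ₗ[ℝ] A →ₗ[ℝ] A, IsJBProduct u m →
      ∀ p ∈ P, ∀ a : A, m p a = multOp u J p a) := by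
  have hiff : IsJBAlgebra A u ↔ ∀ p ∈ P, ∀ q ∈ P, multOp u J p q = multOp u J q p := by
    constructor
    · rintro ⟨m, hm⟩ p hp q hq
      rw [← hm.mul_eq_multOp hA hJ hp, ← hm.mul_eq_multOp hA hJ hq, hm.comm]
    · intro hsymm
      obtain ⟨m, hm⟩ := hJ.exists_extendsMultOp hA hcomp hsymm
      exact ⟨_, hm.isJBProduct hJ hA hcomp hsymm⟩
  refine ⟨?_, hiff, fun p hp q hq => (hJ.multOp_comm_iff hp hq).symm,
    fun m hm p hp a => hm.mul_eq_multOp hA hJ hp a⟩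
  rw [hiff]
  exact forall₄_congr fun p hp q hq => hJ.multOp_comm_iff hp hq
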